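/- For $p\in[0,1]$ let $\mathrm{BSC}_p$ be the binary symmetric channel with crossover probability $p$, which maps a bit $b$ to $1-b$ with probability $p$ and to $b$ with probability $1-p$, and let $\mathrm{NAND}(a,b)=1-ab$ for $a,b\in\{0,1\}$. Consider the Markov chain $(\eta_t)_{t\ge 0}$ on the space of configurations $\{0,1\}^{\mathbb Z}$ (with the product topology and product $\sigma$-algebra) in which, given $\eta_t$, all sites $n\in\mathbb Z$ are updated independently by $$\eta_{t+1}(n)=\mathrm{NAND}\bigl(\mathrm{BSC}_p(\eta_t(n-1)),\,\mathrm{BSC}_p(\eta_t(n))\bigr),$$ where all the channels, two for each site $n$, act independently. Let $A'_p$ denote its transition operator. Theorem. There exists $\epsilon\in(0,1]$ such that for every $p\in(0,\epsilon)$ the probabilistic cellular automaton $A'_p$ is ergodic, i.e. there is a (necessarily unique) probability measure $\mu$ on $\{0,1\}^{\mathbb Z}$ such that $\mu A'_p=\mu$ and, for every probability measure $\nu$ on $\{0,1\}^{\mathbb Z}$, $\nu (A'_p)^n$ converges weakly to $\mu$ as $n\to\infty$. -/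

import Mathlib

open MeasureTheory ProbabilityTheory Filter Topology

/-- The transition law of an elementary one-dimensional probabilistic cellular automaton with
alphabet `A`.  `f a b` is the law of the new state of a site whose left neighbour is in state `a`
and which is itself in state `b`.  Given the configuration `η`, all sites `n : ℤ` are updated
independently of each other, site `n` according to the law `f (η (n - 1)) (η n)`. -/
noncomputable def pcaLaw {A : Type*} [MeasurableSpace A] (f : A → A → Measure A) (η : ℤ → A) :
    Measure (ℤ → A) :=
  Measure.infinitePi fun n => f (η (n - 1)) (η n)

theorem measurable_pcaLaw {A : Type*} [MeasurableSpace A] [Countable A]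
    [MeasurableSingletonClass A] (f : A → A → Measure A) [∀ a b, IsProbabilityMeasure (f a b)] :
    Measurable (pcaLaw f) := by
  have (η : ℤ → A) : IsProbabilityMeasure (pcaLaw f η) := by
    unfold pcaLaw; infer_instance
  refine Measurable.measure_of_isPiSystem_of_isProbabilityMeasure
    (S := squareCylinders fun _ : ℤ => {s : Set A | MeasurableSet s})
    (generateFrom_squareCylinders (α := fun _ : ℤ => A)).symm
    (isPiSystem_squareCylinders (fun _ => MeasurableSpace.isPiSystem_measurableSet)
      fun _ => MeasurableSet.univ) ?_
  rintro _ ⟨s, t, ht, rfl⟩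
  have ht' (n : ℤ) : MeasurableSet (t n) := ht n (Set.mem_univ n)
  simp only [pcaLaw]
  simp_rw [Measure.infinitePi_pi _ (fun n _ => ht' n)]
  refine Finset.measurable_prod _ fun n _ => ?_
  have h1 : Measurable fun η : ℤ → A => (η (n - 1), η n) :=
    (measurable_pi_apply (n - 1)).prodMk (measurable_pi_apply n)
  exact (measurable_of_countable fun x : A × A => f x.1 x.2 (t n)).comp h1

/-- The transition operator of the elementary probabilistic cellular automaton with local rule `f`,
as a Markov kernel on the space `A^ℤ` of configurations. -/
noncomputable def pcaKernel {A : Type*} [MeasurableSpace A] [Countable A]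
    [MeasurableSingletonClass A] (f : A → A → Measure A) [∀ a b, IsProbabilityMeasure (f a b)] :
    Kernel (ℤ → A) (ℤ → A) where
  toFun := pcaLaw f
  measurable' := measurable_pcaLaw f

instance instIsMarkovKernelPcaKernel {A : Type*} [MeasurableSpace A] [Countable A]
    [MeasurableSingletonClass A] (f : A → A → Measure A) [∀ a b, IsProbabilityMeasure (f a b)] :
    IsMarkovKernel (pcaKernel f) where
  isProbabilityMeasure η := by
    change IsProbabilityMeasure (pcaLaw f η)
    unfold pcaLaw; infer_instance

/-- One step `ν ↦ ν F` of the Markov chain with transition kernel `F`, acting on probability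
measures. -/
noncomputable def markovStep {X : Type*} [MeasurableSpace X] (F : Kernel X X) [IsMarkovKernel F]
    (ν : ProbabilityMeasure X) : ProbabilityMeasure X :=
  ⟨(ν : Measure X).bind F, inferInstance⟩

/-- Ergodicity of a Markov chain with transition kernel `F` on a topological space: there is a
probability measure `μ` with `μ F = μ` such that `ν F ^ n` converges weakly to `μ` for every
initial probability measure `ν`. (The topology of `ProbabilityMeasure X` is that of weak
convergence.) -/
def IsErgodicChain {X : Type*} [TopologicalSpace X] [MeasurableSpace X] [OpensMeasurableSpace X]
    (F : Kernel X X) [IsMarkovKernel F] : Prop :=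
  ∃ μ : ProbabilityMeasure X, markovStep F μ = μ ∧
    ∀ ν : ProbabilityMeasure X, Tendsto (fun n : ℕ => (markovStep F)^[n] ν) atTop (𝓝 μ)

/-- The output law of the binary symmetric channel with crossover probability `p` on input `b`:
`!b` with probability `p`, and `b` with probability `1 - p`. -/
noncomputable def bsc (p : unitInterval) (b : Bool) : Measure Bool :=
  bernoulliMeasure (!b) b p

instance instIsProbabilityMeasureBsc (p : unitInterval) (b : Bool) :
    IsProbabilityMeasure (bsc p b) := by
  unfold bsc; infer_instance

/-- The local rule with edge noise: the law of `NAND (BSC_p a) (BSC_p b)`, where the two binary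
symmetric channels are independent. -/
noncomputable def nandEdgeRule (p : unitInterval) (a b : Bool) : Measure Bool :=
  ((bsc p a).prod (bsc p b)).map fun x => !(x.1 && x.2)

instance instIsProbabilityMeasureNandEdgeRule (p : unitInterval) (a b : Bool) :
    IsProbabilityMeasure (nandEdgeRule p a b) :=
  Measure.isProbabilityMeasure_map (measurable_of_countable _).aemeasurable

/-! For `p ≤ 1/2` a noisy channel either transmits its input or replaces it by a fixed bit, each bit
having probability `p`. The same noise can drive an envelope automaton with a third symbol, the
unknown bit, and Kleene's NAND. Started from unknown bits everywhere, the envelope is compatible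
with the automaton from every initial law: wherever its symbol is known, the state no longer depends
on the start. Cylinder masses are thus determined up to the density of unknown bits
(`measureReal_pi_mem_Icc`), and compactness turns the decay of this density into ergodicity
(`isErgodicChain_of_pi`).

The decay comes from a potential. A weight on three consecutive symbols is paired with a flux whose
contributions cancel under translation invariant laws. For every four-symbol pattern the expected
increment, flux included, is at most `-p ^ 2` if the pattern contains an unknown bit and zero
otherwise (`driftCheck_all`, a finite computation). Each step therefore lowers the mean weight by at
least `p ^ 2` times the density. As the mean weight is bounded, the densities are summable
(`tendsto_unknownDensity`). -/

/-! ### Integer polynomials as coefficient lists -/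

/-- The value at `p` of the polynomial with the given list of coefficients. -/
def polyEval (p : ℝ) : List ℤ → ℝ
  | [] => 0
  | c :: l => c + p * polyEval p l

/-- Integer lists make the drift inequalities a kernel computation. Trailing zeros are never
removed, so a vanishing polynomial may be a nonempty list. -/
def polyAdd : List ℤ → List ℤ → List ℤ
  | [], m => m
  | l, [] => l
  | c :: l, d :: m => (c + d) :: polyAdd l m

def polySmul (c : ℤ) : List ℤ → List ℤ
  | [] => []
  | d :: l => (c * d) :: polySmul c l

def polyMul : List ℤ → List ℤ → List ℤ
  | [], _ => []
  | c :: l, m => polyAdd (polySmul c m) (0 :: polyMul l m)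

def polySub (l m : List ℤ) : List ℤ := polyAdd l (polySmul (-1) m)

theorem polyEval_add (p : ℝ) (l m : List ℤ) :
    polyEval p (polyAdd l m) = polyEval p l + polyEval p m := by
  fun_induction polyAdd l m with
  | case1 m => simp [polyEval]
  | case2 l h => simp [polyEval]
  | case3 c l d m ih => simp only [polyEval, ih]; push_cast; ring

theorem polyEval_smul (p : ℝ) (c : ℤ) (l : List ℤ) :
    polyEval p (polySmul c l) = c * polyEval p l := by
  induction l with
  | nil => simp [polySmul, polyEval]
  | cons d l ih => simp only [polySmul, polyEval, ih]; push_cast; ring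

theorem polyEval_mul (p : ℝ) (l m : List ℤ) :
    polyEval p (polyMul l m) = polyEval p l * polyEval p m := by
  induction l with
  | nil => simp [polyMul, polyEval]
  | cons d l ih =>
    simp only [polyMul, polyEval, ih, polyEval_add, polyEval_smul]; push_cast; ring

theorem polyEval_sub (p : ℝ) (l m : List ℤ) :
    polyEval p (polySub l m) = polyEval p l - polyEval p m := by
  simp only [polySub, polyEval_add, polyEval_smul]; push_cast; ring

/-- The sum of the absolute values of the coefficients. -/
def coeffNorm : List ℤ → ℤ
  | [] => 0
  | c :: l => |c| + coeffNorm l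

theorem abs_polyEval_le {p : ℝ} (h0 : 0 ≤ p) (h1 : p ≤ 1) (l : List ℤ) :
    |polyEval p l| ≤ coeffNorm l := by
  induction l with
  | nil => simp [polyEval, coeffNorm]
  | cons c l ih =>
    simp only [polyEval, coeffNorm]
    push_cast
    refine (abs_add_le _ _).trans (add_le_add le_rfl ?_)
    rw [abs_mul, abs_of_nonneg h0]
    exact (mul_le_of_le_one_left (abs_nonneg _) h1).trans ih

/-- The coefficients of order `0` and `1` are not positive, the coefficient of order `2` is at most
`-2`, and it dominates the remaining coefficients at arguments at most `B⁻¹`. -/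
def negQuadratic (B : ℤ) : List ℤ → Bool
  | c :: d :: e :: l => decide (c ≤ 0) && decide (d ≤ 0) && decide (e ≤ -2) &&
      decide (coeffNorm l ≤ B)
  | _ => false

theorem polyEval_le_of_negQuadratic {B : ℤ} {l : List ℤ} (h : negQuadratic B l = true) {p : ℝ}
    (h0 : 0 ≤ p) (h1 : p ≤ 1) (hB : p * B ≤ 1) : polyEval p l ≤ -p ^ 2 := by
  match l, h with
  | c :: d :: e :: l, h =>
    simp only [negQuadratic, Bool.and_eq_true, decide_eq_true_eq] at h
    obtain ⟨⟨⟨hc, hd⟩, he⟩, hl⟩ := h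
    have hc' : (c : ℝ) ≤ 0 := by exact_mod_cast hc
    have hd' : (d : ℝ) ≤ 0 := by exact_mod_cast hd
    have he' : (e : ℝ) ≤ -2 := by exact_mod_cast he
    have hl' : (coeffNorm l : ℝ) ≤ B := by exact_mod_cast hl
    -- As `p * B ≤ 1`, the terms beyond order two contribute at most `p ^ 2`, which leaves half of
    -- the `-2 * p ^ 2`.
    have h3 : p * polyEval p l ≤ 1 :=
      (mul_le_mul_of_nonneg_left
        ((le_abs_self _).trans ((abs_polyEval_le h0 h1 l).trans hl')) h0).trans hB
    simp only [polyEval]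
    nlinarith [mul_nonpos_of_nonneg_of_nonpos h0 hd',
      mul_le_mul_of_nonneg_left (add_le_add he' h3) (sq_nonneg p)]

theorem polyEval_eq_zero {l : List ℤ} (h : l.all (· == 0) = true) (p : ℝ) :
    polyEval p l = 0 := by
  induction l with
  | nil => rfl
  | cons c l ih =>
    simp only [List.all_cons, Bool.and_eq_true, beq_iff_eq] at h
    simp [polyEval, h.1, ih h.2]

/-! ### The envelope automaton -/

/-- Kleene's three-valued NAND, where `none` is an unknown bit. -/
def kleeneNand : Option Bool → Option Bool → Option Bool
  | some false, _ => some true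
  | _, some false => some true
  | some true, some true => some false
  | _, _ => none

/-- The probability that a noisy channel surely outputs `true`. -/
def surePoly : Option Bool → List ℤ
  | some true => [1, -1]
  | _ => [0, 1]

/-- The probability that a noisy channel possibly outputs `true`. -/
def possiblePoly : Option Bool → List ℤ
  | some false => [0, 1]
  | _ => [1, -1]

/-- The transition probabilities of the envelope automaton, as polynomials in the noise level. -/
def transPoly (a b : Option Bool) : Option Bool → List ℤ
  | some false => polyMul (surePoly a) (surePoly b)
  | some true => polySub [1] (polyMul (possiblePoly a) (possiblePoly b))
  | none => polySub (polyMul (possiblePoly a) (possiblePoly b))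
      (polyMul (surePoly a) (surePoly b))

/-- The sum of a family of polynomials indexed by the three symbols. -/
def polySum (f : Option Bool → List ℤ) : List ℤ :=
  polyAdd (f none) (polyAdd (f (some true)) (f (some false)))

theorem polyEval_sum (p : ℝ) (f : Option Bool → List ℤ) :
    polyEval p (polySum f) = ∑ a, polyEval p (f a) := by
  simp [polySum, polyEval_add, Fintype.sum_option]

/-- The weight of a pattern of three consecutive symbols: a polynomial of degree one in the noise
level, chosen so that its mean decreases along the envelope automaton. Patterns without unknown bits have weight zero. -/
def weight : Option Bool → Option Bool → Option Bool → List ℤ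
  | some false, some false, none => [2374, 1876]
  | some false, some true, none => [4997, 1117]
  | some false, none, some false => [-1877, 8996]
  | some false, none, some true => [-1123, 0]
  | some false, none, none => [750, -153]
  | some true, some false, none => [2374, 4874]
  | some true, some true, none => [3498, 4721]
  | some true, none, some false => [-1123, 0]
  | some true, none, some true => [-748, 504]
  | some true, none, none => [1125, 1491]
  | none, some false, some false => [2374, 1876]
  | none, some false, some true => [2374, 4874]
  | none, some false, none => [4748, 3500]
  | none, some true, some false => [4997, 1117]
  | none, some true, some true => [3498, 4721]
  | none, some true, none => [6744, 472]
  | none, none, some false => [750, -153]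
  | none, none, some true => [1125, 1491]
  | none, none, none => [2998, 2982]
  | _, _, _ => []

/-- The flux that compares the weights of a pattern and of its translate. -/
def flux : Option Bool → Option Bool → Option Bool → List ℤ
  | some false, some false, none => [0, -3498]
  | some false, some true, none => [-3498, 0]
  | some false, none, some false => [0, -4372]
  | some false, none, some true => [-1124, 3129]
  | some false, none, none => [-1124, 3026]
  | some true, some false, none => [0, -4997]
  | some true, some true, none => [-2374, 0]
  | some true, none, some false => [2247, -3129]
  | some true, none, some true => [374, 0]
  | some true, none, none => [374, -2248]
  | none, some false, some false => [-2374, 1622]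
  | none, some false, some true => [-2374, 123]
  | none, some false, none => [-2374, -1624]
  | none, some true, some false => [-1499, -1117]
  | none, some true, some true => [-1124, -4721]
  | none, some true, none => [-3372, -236]
  | none, none, some false => [374, -2873]
  | none, none, some true => [-1499, 757]
  | none, none, none => [-1499, -1491]
  | _, _, _ => []

/-- The expected weight, after one step, of the pattern that replaces `a b c d`. -/
def nextWeight (a b c d : Option Bool) : List ℤ :=
  polySum fun x => polyMul (transPoly a b x) (polySum fun y => polyMul (transPoly b c y)
    (polySum fun z => polyMul (transPoly c d z) (weight x y z)))

/-- The expected increment of the weight in one step, up to a flux. -/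
def drift (a b c d : Option Bool) : List ℤ :=
  polySub (polyAdd (nextWeight a b c d) (flux b c d)) (polyAdd (weight a b c) (flux a b c))

/-! ### Finite verification of the drift inequality -/

def symbols : List (Option Bool) := [none, some true, some false]

theorem mem_symbols (a : Option Bool) : a ∈ symbols := by
  rcases a with _ | _ | _ <;> simp [symbols]

/-- Strict loss is required at order two only: on the pattern of four unknown bits the orders zero
and one of the drift cancel. -/
def driftCheck (B : ℤ) (a b c d : Option Bool) : Bool :=
  if (a.isNone || b.isNone || c.isNone || d.isNone) then negQuadratic B (drift a b c d)
  else (drift a b c d).all (· == 0)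

theorem driftCheck_all :
    (symbols.all fun a => symbols.all fun b => symbols.all fun c => symbols.all fun d =>
      driftCheck 2000000 a b c d) = true := by
  decide +kernel

theorem polyEval_drift_le {p : ℝ} (h0 : 0 ≤ p) (hp : p ≤ 1 / 2000000) (a b c d : Option Bool) :
    polyEval p (drift a b c d) ≤ -(if a = none then p ^ 2 else 0) := by
  have h := driftCheck_all
  simp only [List.all_eq_true] at h
  have h := h a (mem_symbols a) b (mem_symbols b) c (mem_symbols c) d (mem_symbols d)
  unfold driftCheck at h
  split_ifs at h with hn
  · have := polyEval_le_of_negQuadratic h h0 (by linarith) (by push_cast; linarith)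
    -- The loss occurs wherever the unknown bit sits. Keeping it only for `a = none` counts exactly
    -- the density at one site.
    split_ifs
    · exact this
    · nlinarith [sq_nonneg p]
  · have ha : a ≠ none := by rintro rfl; simp at hn
    rw [if_neg ha, polyEval_eq_zero h]
    simp

/-! ### A common source of noise -/

instance instMeasurableSpaceOptionBool : MeasurableSpace (Option Bool) := ⊤

instance instDiscreteMeasurableSpaceOptionBool : DiscreteMeasurableSpace (Option Bool) :=
  ⟨fun _ => trivial⟩

theorem measureReal_map_singleton {α β : Type*} [Fintype α] [MeasurableSpace α]
    [MeasurableSingletonClass α] [MeasurableSpace β] [MeasurableSingletonClass β] [DecidableEq β]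
    (μ : Measure α) [IsFiniteMeasure μ] (F : α → β) (c : β) :
    (μ.map F).real {c} = ∑ x, if F x = c then μ.real {x} else 0 := by
  have h : (μ.map F).real {c} = ∫ x, ({c} : Set β).indicator (1 : β → ℝ) (F x) ∂μ := by
    rw [measureReal_def, Measure.map_apply (measurable_of_countable _) (measurableSet_singleton c),
      ← measureReal_def, ← integral_indicator_one
        ((measurable_of_countable F) (measurableSet_singleton c))]
    rfl
  rw [h, integral_fintype .of_finite]
  refine Finset.sum_congr rfl fun x _ => ?_
  by_cases hc : F x = c <;> simp [hc]

/-- The noise of one channel: the channel transmits its input (`none`) or replaces it by a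
fixed bit. -/
noncomputable def channelNoise (p : unitInterval) : Measure (Option Bool) :=
  ENNReal.ofReal p • Measure.dirac (some true) + ENNReal.ofReal p • Measure.dirac (some false) +
    ENNReal.ofReal (1 - 2 * p) • Measure.dirac none

instance instIsProbabilityMeasureChannelNoise (p : unitInterval) [hp : Fact ((p : ℝ) ≤ 1 / 2)] :
    IsProbabilityMeasure (channelNoise p) := by
  have h0 : 0 ≤ (p : ℝ) := p.2.1
  have h1 : 0 ≤ 1 - 2 * (p : ℝ) := by linarith [hp.out]
  constructor
  simp only [channelNoise, Measure.coe_add, Measure.coe_smul, Pi.add_apply, Pi.smul_apply,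
    measure_univ, smul_eq_mul, mul_one]
  rw [← ENNReal.ofReal_add h0 h0, ← ENNReal.ofReal_add (by linarith) h1,
    ← ENNReal.ofReal_one]
  congr 1
  ring

/-- The probabilities of the values of the channel noise. -/
def noiseWeight (p : ℝ) : Option Bool → ℝ
  | none => 1 - 2 * p
  | some _ => p

theorem channelNoise_real_singleton (p : unitInterval) [hp : Fact ((p : ℝ) ≤ 1 / 2)]
    (n : Option Bool) : (channelNoise p).real {n} = noiseWeight p n := by
  have h0 : 0 ≤ (p : ℝ) := p.2.1
  have h1 : 0 ≤ 1 - 2 * (p : ℝ) := by linarith [hp.out]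
  rcases n with _ | _ | _ <;> simp [channelNoise, noiseWeight, measureReal_def, h0, h1]

/-- Replacing the input by its own value is harmless, so the input is flipped with probability
exactly `p`. -/
theorem channelNoise_map_getD (p : unitInterval) [Fact ((p : ℝ) ≤ 1 / 2)] (b : Bool) :
    (channelNoise p).map (fun n => n.getD b) = bsc p b := by
  have : IsProbabilityMeasure ((channelNoise p).map fun n => n.getD b) :=
    Measure.isProbabilityMeasure_map (measurable_of_countable _).aemeasurable
  refine Measure.ext_of_singleton fun c => ?_
  rw [← ENNReal.toReal_eq_toReal_iff' (measure_ne_top _ _) (measure_ne_top _ _)]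
  change ((channelNoise p).map _).real {c} = (bsc p b).real {c}
  rw [measureReal_map_singleton, bsc, bernoulliMeasure_real_apply _ (measurableSet_singleton c)]
  simp only [channelNoise_real_singleton, Fintype.sum_option, Fintype.sum_bool, noiseWeight]
  cases b <;> cases c <;> simp <;> ring

/-- The law of the noise of the two channels of a site. -/
noncomputable def siteNoise (p : unitInterval) : Measure (Option Bool × Option Bool) :=
  (channelNoise p).prod (channelNoise p)

instance instIsProbabilityMeasureSiteNoise (p : unitInterval) [Fact ((p : ℝ) ≤ 1 / 2)] :
    IsProbabilityMeasure (siteNoise p) := by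
  unfold siteNoise; infer_instance

/-- The effect of the channel noise on a possibly unknown bit. -/
def noisy (n a : Option Bool) : Option Bool := n.elim a some

/-- The local rule of the envelope automaton. -/
noncomputable def envelopeRule (p : unitInterval) (a b : Option Bool) : Measure (Option Bool) :=
  (siteNoise p).map fun n => kleeneNand (noisy n.1 a) (noisy n.2 b)

instance instIsProbabilityMeasureEnvelopeRule (p : unitInterval) [Fact ((p : ℝ) ≤ 1 / 2)]
    (a b : Option Bool) : IsProbabilityMeasure (envelopeRule p a b) :=
  Measure.isProbabilityMeasure_map (measurable_of_countable _).aemeasurable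

/-- The joint local rule of the automaton and of its envelope, driven by the same noise. -/
noncomputable def coupledRule (p : unitInterval) (a b : Bool × Option Bool) :
    Measure (Bool × Option Bool) :=
  (siteNoise p).map fun n =>
    (!(n.1.getD a.1 && n.2.getD b.1), kleeneNand (noisy n.1 a.2) (noisy n.2 b.2))

instance instIsProbabilityMeasureCoupledRule (p : unitInterval) [Fact ((p : ℝ) ≤ 1 / 2)]
    (a b : Bool × Option Bool) : IsProbabilityMeasure (coupledRule p a b) :=
  Measure.isProbabilityMeasure_map (measurable_of_countable _).aemeasurable

theorem coupledRule_map_fst (p : unitInterval) [Fact ((p : ℝ) ≤ 1 / 2)]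
    (a b : Bool × Option Bool) :
    (coupledRule p a b).map Prod.fst = nandEdgeRule p a.1 b.1 := by
  rw [coupledRule, Measure.map_map (measurable_of_countable _) (measurable_of_countable _),
    nandEdgeRule, ← channelNoise_map_getD, ← channelNoise_map_getD,
    Measure.map_prod_map _ _ (measurable_of_countable _) (measurable_of_countable _),
    Measure.map_map (measurable_of_countable _) (measurable_of_countable _)]
  rfl

theorem coupledRule_map_snd (p : unitInterval) (a b : Bool × Option Bool) :
    (coupledRule p a b).map Prod.snd = envelopeRule p a.2 b.2 := by
  rw [coupledRule, Measure.map_map (measurable_of_countable _) (measurable_of_countable _)]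
  rfl

/-- The pairs of a bit and a symbol that does not contradict it. -/
def compatible : Set (Bool × Option Bool) := {a | a.2 = none ∨ a.2 = some a.1}

/-- Kleene's NAND asserts a bit only when every completion of its inputs gives that bit, and both
components see the same noise. -/
theorem coupledRule_compl_compatible (p : unitInterval) {a b : Bool × Option Bool}
    (ha : a ∈ compatible) (hb : b ∈ compatible) : coupledRule p a b compatibleᶜ = 0 := by
  rw [coupledRule, Measure.map_apply (measurable_of_countable _) (Set.to_countable _).measurableSet]
  convert measure_empty (μ := siteNoise p)
  ext ⟨n, m⟩
  obtain ⟨a, s⟩ := a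
  obtain ⟨b, t⟩ := b
  simp only [compatible, Set.mem_ofPred_eq] at ha hb
  simp only [compatible, Set.mem_preimage, Set.mem_compl_iff, Set.mem_ofPred_eq,
    Set.mem_empty_iff_false, iff_false, not_not]
  rcases ha with rfl | rfl <;> rcases hb with rfl | rfl <;> revert n m a b <;> decide

theorem siteNoise_real_singleton (p : unitInterval) [Fact ((p : ℝ) ≤ 1 / 2)]
    (n : Option Bool × Option Bool) :
    (siteNoise p).real {n} = noiseWeight p n.1 * noiseWeight p n.2 := by
  rw [siteNoise, ← Prod.mk.eta (p := n), ← Set.singleton_prod_singleton, measureReal_prod_prod,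
    channelNoise_real_singleton, channelNoise_real_singleton]

/-- The link between the verified polynomials and the actual law. The output is `false` when both
channels surely give `true`, and `true` unless both possibly do. -/
theorem envelopeRule_real_singleton (p : unitInterval) [Fact ((p : ℝ) ≤ 1 / 2)]
    (a b c : Option Bool) :
    (envelopeRule p a b).real {c} = polyEval p (transPoly a b c) := by
  rw [envelopeRule, measureReal_map_singleton]
  simp only [siteNoise_real_singleton, Fintype.sum_prod_type, Fintype.sum_option, Fintype.sum_bool]
  rcases a with _ | _ | _ <;> rcases b with _ | _ | _ <;> rcases c with _ | _ | _ <;>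
    simp [kleeneNand, noisy, noiseWeight, transPoly, polyEval_sub, polyEval_mul, surePoly,
      possiblePoly, polyEval] <;> ring

/-! ### Generalities on probabilistic cellular automata -/

/-- Used for both projections of the coupled automaton, each of which is again a probabilistic
cellular automaton. -/
theorem pcaLaw_map {A B : Type*} [MeasurableSpace A] [Countable A] [MeasurableSingletonClass A]
    [MeasurableSpace B] (f : A → A → Measure A) [∀ a b, IsProbabilityMeasure (f a b)]
    (g : B → B → Measure B) {π : A → B}
    (h : ∀ a b, (f a b).map π = g (π a) (π b)) (η : ℤ → A) :
    (pcaLaw f η).map (fun ξ n => π (ξ n)) = pcaLaw g fun n => π (η n) := by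
  unfold pcaLaw
  rw [Measure.infinitePi_map_pi _ fun _ => measurable_of_countable _]
  simp only [h]

theorem measurable_shift {A : Type*} [MeasurableSpace A] :
    Measurable fun (ξ : ℤ → A) (n : ℤ) => ξ (n + 1) := by fun_prop

section General

variable {A : Type*} [MeasurableSpace A] [Countable A] [MeasurableSingletonClass A]
  (f : A → A → Measure A) [∀ a b, IsProbabilityMeasure (f a b)]

instance instIsProbabilityMeasurePcaLaw (η : ℤ → A) : IsProbabilityMeasure (pcaLaw f η) := by
  unfold pcaLaw; infer_instance

theorem pcaLaw_pi (η : ℤ → A) (s : Finset ℤ) (t : ℤ → Set A) :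
    pcaLaw f η (Set.pi s t) = ∏ n ∈ s, f (η (n - 1)) (η n) (t n) :=
  Measure.infinitePi_pi _ fun _ _ => (Set.to_countable _).measurableSet

theorem pcaLaw_map_shift (η : ℤ → A) :
    (pcaLaw f η).map (fun ξ n => ξ (n + 1)) = pcaLaw f fun n => η (n + 1) := by
  refine Measure.eq_infinitePi _ fun s t ht => ?_
  have hpre : (fun (ξ : ℤ → A) n => ξ (n + 1)) ⁻¹' Set.pi s t =
      Set.pi (s.map (addRightEmbedding (1 : ℤ))) fun n => t (n - 1) := by
    ext ξ
    simp only [Set.mem_preimage, Set.mem_pi, Finset.coe_map, Set.forall_mem_image,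
      addRightEmbedding_apply, add_sub_cancel_right]
  rw [Measure.map_apply (by fun_prop) (.pi s.countable_toSet fun _ _ => ht _), hpre, pcaLaw_pi]
  simp

/-- If a measurable map intertwines the local laws, it intertwines the Markov steps. -/
theorem markovStep_map {X Y : Type*} [MeasurableSpace X] [MeasurableSpace Y] {F : Kernel X X}
    {G : Kernel Y Y} [IsMarkovKernel F] [IsMarkovKernel G] {π : X → Y} (hπ : Measurable π)
    (h : ∀ x, (F x).map π = G (π x)) (ν : ProbabilityMeasure X) :
    (markovStep F ν).map hπ.aemeasurable = markovStep G (ν.map hπ.aemeasurable) := by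
  apply Subtype.ext
  change ((ν : Measure X).bind F).map π = ((ν : Measure X).map π).bind G
  ext s hs
  rw [Measure.map_apply hπ hs, Measure.bind_apply (hπ hs) F.measurable.aemeasurable,
    Measure.bind_apply hs G.measurable.aemeasurable, lintegral_map (G.measurable_coe hs) hπ]
  refine lintegral_congr fun x => ?_
  rw [← h, Measure.map_apply hπ hs]

theorem markovStep_iterate_map {X Y : Type*} [MeasurableSpace X] [MeasurableSpace Y]
    {F : Kernel X X} {G : Kernel Y Y} [IsMarkovKernel F] [IsMarkovKernel G] {π : X → Y}
    (hπ : Measurable π) (h : ∀ x, (F x).map π = G (π x)) (ν : ProbabilityMeasure X) (n : ℕ) :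
    ((markovStep F)^[n] ν).map hπ.aemeasurable = (markovStep G)^[n] (ν.map hπ.aemeasurable) := by
  induction n generalizing ν with
  | zero => rfl
  | succ n ih => rw [Function.iterate_succ_apply, ih, markovStep_map hπ h]; rfl

theorem integral_markovStep {X : Type*} [MeasurableSpace X] (F : Kernel X X) [IsMarkovKernel F]
    (ν : ProbabilityMeasure X) {h : X → ℝ} (hh : Integrable h (markovStep F ν : Measure X)) :
    ∫ x, h x ∂(markovStep F ν : Measure X) = ∫ x, ∫ y, h y ∂F x ∂(ν : Measure X) := by
  have hb : (markovStep F ν : Measure X) = (F ∘ₖ Kernel.const Unit (ν : Measure X)) () := by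
    rw [Kernel.comp_apply, Kernel.const_apply]; rfl
  rw [hb] at hh ⊢
  rw [Kernel.integral_comp hh, Kernel.const_apply]

theorem markovStep_apply {X : Type*} [MeasurableSpace X] (F : Kernel X X) [IsMarkovKernel F]
    (ν : ProbabilityMeasure X) {s : Set X} (hs : MeasurableSet s) :
    (markovStep F ν : Measure X) s = ∫⁻ x, F x s ∂(ν : Measure X) :=
  Measure.bind_apply hs F.measurable.aemeasurable

/-- A closed set of states is preserved by the automaton. -/
theorem markovStep_eval_eq_zero {G : Set A} (hG : ∀ a ∈ G, ∀ b ∈ G, f a b Gᶜ = 0)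
    {ν : ProbabilityMeasure (ℤ → A)} (hν : ∀ n, (ν : Measure (ℤ → A)) {η | η n ∉ G} = 0) (n : ℤ) :
    (markovStep (pcaKernel f) ν : Measure (ℤ → A)) {η | η n ∉ G} = 0 := by
  have hs : MeasurableSet {η : ℤ → A | η n ∉ G} :=
    (measurable_pi_apply (X := fun _ => A) n) (Set.to_countable Gᶜ).measurableSet
  rw [markovStep_apply _ _ hs, lintegral_eq_zero_iff ((pcaKernel f).measurable_coe hs)]
  have h1 : ∀ᵐ η ∂(ν : Measure (ℤ → A)), η (n - 1) ∈ G := by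
    rw [ae_iff]; exact hν _
  have h2 : ∀ᵐ η ∂(ν : Measure (ℤ → A)), η n ∈ G := by
    rw [ae_iff]; exact hν _
  filter_upwards [h1, h2] with η h1 h2
  have : {ξ : ℤ → A | ξ n ∉ G} = Set.pi ({n} : Finset ℤ) fun _ => Gᶜ := by
    ext ξ; simp
  change pcaLaw f η _ = 0
  rw [this, pcaLaw_pi]
  simpa using hG _ h1 _ h2

theorem markovStep_iterate_eval_eq_zero {G : Set A} (hG : ∀ a ∈ G, ∀ b ∈ G, f a b Gᶜ = 0)
    {ν : ProbabilityMeasure (ℤ → A)} (hν : ∀ n, (ν : Measure (ℤ → A)) {η | η n ∉ G} = 0) (k : ℕ)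
    (n : ℤ) :
    ((markovStep (pcaKernel f))^[k] ν : Measure (ℤ → A)) {η | η n ∉ G} = 0 := by
  induction k generalizing n with
  | zero => exact hν n
  | succ k ih => rw [Function.iterate_succ_apply']; exact markovStep_eval_eq_zero f hG ih n

/-- The automaton preserves translation invariance. -/
theorem markovStep_iterate_map_shift {ν : ProbabilityMeasure (ℤ → A)}
    (hν : ν.map (measurable_shift (A := A)).aemeasurable = ν) (k : ℕ) :
    ((markovStep (pcaKernel f))^[k] ν).map (measurable_shift (A := A)).aemeasurable =
      (markovStep (pcaKernel f))^[k] ν := by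
  rw [markovStep_iterate_map (G := pcaKernel f) measurable_shift (pcaLaw_map_shift f), hν]

/-- The expectation under the transition law of a function of three consecutive sites. -/
theorem integral_pcaLaw_three [Fintype A] (η : ℤ → A) (h : A → A → A → ℝ) :
    ∫ ξ, h (ξ 1) (ξ 2) (ξ 3) ∂pcaLaw f η =
      ∑ x, (f (η 0) (η 1)).real {x} * ∑ y, (f (η 1) (η 2)).real {y} *
        ∑ z, (f (η 2) (η 3)).real {z} * h x y z := by
  have hm : Measurable fun ξ : ℤ → A => (ξ 1, ξ 2, ξ 3) := by fun_prop
  have h1 : ∫ ξ, h (ξ 1) (ξ 2) (ξ 3) ∂pcaLaw f η =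
      ∫ x, h x.1 x.2.1 x.2.2 ∂(pcaLaw f η).map fun ξ => (ξ 1, ξ 2, ξ 3) := by
    rw [integral_map hm.aemeasurable (measurable_of_countable _).aestronglyMeasurable]
  have : IsProbabilityMeasure ((pcaLaw f η).map fun ξ => (ξ 1, ξ 2, ξ 3)) :=
    Measure.isProbabilityMeasure_map hm.aemeasurable
  rw [h1, integral_fintype .of_finite]
  simp only [Fintype.sum_prod_type, Finset.mul_sum]
  refine Finset.sum_congr rfl fun x _ => Finset.sum_congr rfl fun y _ =>
    Finset.sum_congr rfl fun z _ => ?_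
  have h2 : (fun ξ : ℤ → A => (ξ 1, ξ 2, ξ 3)) ⁻¹' {(x, y, z)} =
      Set.pi ({1, 2, 3} : Finset ℤ) fun n => if n = 1 then {x} else if n = 2 then {y} else {z} := by
    ext ξ; simp
  rw [measureReal_def, Measure.map_apply hm (measurableSet_singleton _), h2, pcaLaw_pi]
  simp [measureReal_def]
  ring

end General

/-! ### Cylinders, compactness and a criterion for ergodicity -/

theorem isClopen_pi {A : Type*} [TopologicalSpace A] [DiscreteTopology A] (s : Finset ℤ)
    (t : ℤ → Set A) : IsClopen (Set.pi (s : Set ℤ) t) :=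
  ⟨isClosed_set_pi fun _ _ => isClosed_discrete _,
    isOpen_set_pi s.finite_toSet fun _ _ => isOpen_discrete _⟩

/-- Probability measures with the same masses of cylinders coincide. -/
theorem probabilityMeasure_ext_of_pi {A : Type*} [MeasurableSpace A]
    {μ ν : ProbabilityMeasure (ℤ → A)}
    (h : ∀ (s : Finset ℤ) (t : ℤ → Set A),
      (μ : Measure (ℤ → A)).real (Set.pi s t) = (ν : Measure (ℤ → A)).real (Set.pi s t)) :
    μ = ν := by
  refine Subtype.ext (?_ : (μ : Measure (ℤ → A)) = ν)
  refine ext_of_generate_finite (squareCylinders fun _ : ℤ => {s : Set A | MeasurableSet s})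
    (generateFrom_squareCylinders (α := fun _ : ℤ => A)).symm
    (isPiSystem_squareCylinders (fun _ => MeasurableSpace.isPiSystem_measurableSet)
      fun _ => MeasurableSet.univ) ?_ (by simp)
  rintro _ ⟨s, t, -, rfl⟩
  exact (ENNReal.toReal_eq_toReal_iff' (measure_ne_top _ _) (measure_ne_top _ _)).1 (h s t)

section Criterion

variable {A : Type*} [MeasurableSpace A] [Fintype A] [TopologicalSpace A] [DiscreteTopology A]
  [BorelSpace A] (f : A → A → Measure A) [∀ a b, IsProbabilityMeasure (f a b)]

/-- The mass of a cylinder depends continuously on the measure. -/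
theorem continuous_measureReal_pi (s : Finset ℤ) (t : ℤ → Set A) :
    Continuous fun ν : ProbabilityMeasure (ℤ → A) => (ν : Measure (ℤ → A)).real (Set.pi s t) := by
  refine continuous_iff_continuousAt.2 fun ν => ?_
  have h := ProbabilityMeasure.tendsto_measure_of_null_frontier_of_tendsto' (tendsto_id (x := 𝓝 ν))
    (E := Set.pi s t) (by rw [(isClopen_pi s t).frontier_eq]; simp)
  exact (ENNReal.tendsto_toReal (measure_ne_top _ _)).comp h

/-- The transition operator has the Feller property. -/
theorem continuous_markovStep_pcaKernel : Continuous (markovStep (pcaKernel f)) := by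
  have hcyl (s : Finset ℤ) (t : ℤ → Set A) : Continuous fun ν : ProbabilityMeasure (ℤ → A) =>
      (markovStep (pcaKernel f) ν : Measure (ℤ → A)).real (Set.pi s t) := by
    let h : (ℤ → A) → ℝ := fun η => ∏ n ∈ s, (f (η (n - 1)) (η n)).real (t n)
    have hc : Continuous h := by
      refine continuous_finsetProd _ fun n _ => ?_
      have h2 : Continuous fun x : A × A => (f x.1 x.2).real (t n) := continuous_of_discreteTopology
      have h3 : Continuous fun η : ℤ → A => (η (n - 1), η n) := by fun_prop
      exact h2.comp h3
    have heq (ν : ProbabilityMeasure (ℤ → A)) :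
        (markovStep (pcaKernel f) ν : Measure (ℤ → A)).real (Set.pi s t) =
          ∫ η, BoundedContinuousFunction.mkOfCompact ⟨h, hc⟩ η ∂(ν : Measure (ℤ → A)) := by
      have hs : MeasurableSet (Set.pi (s : Set ℤ) t) := (isClopen_pi s t).isOpen.measurableSet
      have h1 (η : ℤ → A) : |(Set.pi (s : Set ℤ) t).indicator (1 : (ℤ → A) → ℝ) η| ≤ 1 := by
        by_cases hη : η ∈ Set.pi (s : Set ℤ) t <;> simp [hη]
      rw [← integral_indicator_one hs,
        integral_markovStep (pcaKernel f) ν (.of_bound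
          (measurable_one.indicator hs).aestronglyMeasurable 1 (ae_of_all _ h1))]
      refine integral_congr_ae (ae_of_all _ fun η => ?_)
      simp only [integral_indicator_one hs]
      change (pcaLaw f η).real _ = ∏ n ∈ s, _
      rw [measureReal_def, pcaLaw_pi, ENNReal.toReal_prod]
      rfl
    simp only [heq]
    exact continuous_iff_continuousAt.2 fun ν =>
      ProbabilityMeasure.tendsto_iff_forall_integral_tendsto.1 tendsto_id _
  refine continuous_iff_continuousAt.2 fun ν => ?_
  -- The space of laws is compact, so it suffices to identify cluster points, and cylinder masses do
  -- this.
  refine tendsto_nhds_of_unique_mapClusterPt fun μ hμ => probabilityMeasure_ext_of_pi fun s t => ?_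
  have h1 := hμ.continuousAt_comp (continuous_measureReal_pi s t).continuousAt
  exact eq_of_nhds_neBot (h1.neBot.mono
    (inf_le_inf_left _ ((hcyl s t).continuousAt (x := ν))))

/-- A probabilistic cellular automaton is ergodic if the masses of cylinders after `n` steps depend
less and less on the initial law. -/
theorem isErgodicChain_of_pi [Nonempty A]
    (h : ∀ (s : Finset ℤ) (t : ℤ → Set A), ∃ l q : ℕ → ℝ, Tendsto q atTop (𝓝 0) ∧
      ∀ n (ν : ProbabilityMeasure (ℤ → A)),
        l n ≤ ((markovStep (pcaKernel f))^[n] ν : Measure (ℤ → A)).real (Set.pi s t) ∧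
        ((markovStep (pcaKernel f))^[n] ν : Measure (ℤ → A)).real (Set.pi s t) ≤ l n + q n) :
    IsErgodicChain (pcaKernel f) := by
  have hunique (ν ν' μ μ' : ProbabilityMeasure (ℤ → A))
      (hμ : MapClusterPt μ atTop fun n => (markovStep (pcaKernel f))^[n] ν)
      (hμ' : MapClusterPt μ' atTop fun n => (markovStep (pcaKernel f))^[n] ν') : μ = μ' := by
    refine probabilityMeasure_ext_of_pi fun s t => ?_
    obtain ⟨l, q, hq, hlq⟩ := h s t
    have key (ν μ : ProbabilityMeasure (ℤ → A))
        (hμ : MapClusterPt μ atTop fun n => (markovStep (pcaKernel f))^[n] ν) (n : ℕ) :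
        (μ : Measure (ℤ → A)).real (Set.pi s t) ∈ Set.Icc (l n) (l n + q n) := by
      have h1 := hμ.continuousAt_comp (continuous_measureReal_pi s t).continuousAt
      refine isClosed_Icc.mem_of_mapClusterPt h1 ?_
      filter_upwards [eventually_ge_atTop n] with m hm
      -- The law at time `n + k` is the law at time `n` of the chain started from its law at time
      -- `k`, so the bound uniform in the initial law applies.
      obtain ⟨k, rfl⟩ := Nat.exists_eq_add_of_le hm
      simp only [Function.comp_apply, Function.iterate_add_apply]
      exact hlq n _
    have habs (n : ℕ) : |(μ : Measure (ℤ → A)).real (Set.pi s t) -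
        (μ' : Measure (ℤ → A)).real (Set.pi s t)| ≤ q n := by
      have h1 := key ν μ hμ n
      have h2 := key ν' μ' hμ' n
      rw [abs_le]
      constructor <;> linarith [h1.1, h1.2, h2.1, h2.2]
    exact sub_eq_zero.1 (abs_nonpos_iff.1 (ge_of_tendsto' hq habs))
  let ν₀ : ProbabilityMeasure (ℤ → A) := ⟨Measure.dirac fun _ => Classical.arbitrary A, inferInstance⟩
  obtain ⟨μ, hμ⟩ := exists_clusterPt_of_compactSpace
    (map (fun n => (markovStep (pcaKernel f))^[n] ν₀) atTop)
  have hlim (ν : ProbabilityMeasure (ℤ → A)) :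
      Tendsto (fun n : ℕ => (markovStep (pcaKernel f))^[n] ν) atTop (𝓝 μ) :=
    tendsto_nhds_of_unique_mapClusterPt fun μ' hμ' => hunique ν ν₀ μ' μ hμ' hμ
  refine ⟨μ, ?_, hlim⟩
  have h1 := ((continuous_markovStep_pcaKernel f).tendsto μ).comp (hlim ν₀)
  have h2 := (hlim ν₀).comp (tendsto_add_atTop_nat 1)
  refine tendsto_nhds_unique h1 (h2.congr fun n => ?_)
  simp only [Function.comp_apply, Function.iterate_succ_apply']

end Criterion

/-! ### The density of unknown bits in the envelope automaton -/

theorem integrable_four {A : Type*} [MeasurableSpace A] [Finite A] [MeasurableSingletonClass A]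
    (ν : Measure (ℤ → A)) [IsFiniteMeasure ν] (h : A → A → A → A → ℝ) :
    Integrable (fun η => h (η 0) (η 1) (η 2) (η 3)) ν := by
  have hm : Measurable fun η : ℤ → A => (η 0, η 1, η 2, η 3) := by fun_prop
  exact (Integrable.of_finite (f := fun x : A × A × A × A => h x.1 x.2.1 x.2.2.1 x.2.2.2)
    (μ := ν.map fun η => (η 0, η 1, η 2, η 3))).comp_measurable hm

theorem integral_three_shift {A : Type*} [MeasurableSpace A] [Finite A]
    [MeasurableSingletonClass A] {ν : ProbabilityMeasure (ℤ → A)}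
    (hν : ν.map (measurable_shift (A := A)).aemeasurable = ν) (h : A → A → A → ℝ) :
    ∫ η, h (η 1) (η 2) (η 3) ∂(ν : Measure (ℤ → A)) =
      ∫ η, h (η 0) (η 1) (η 2) ∂(ν : Measure (ℤ → A)) := by
  conv_rhs => rw [← hν]
  rw [ProbabilityMeasure.toMeasure_map, integral_map measurable_shift.aemeasurable]
  · rfl
  · have hm : Measurable fun η : ℤ → A => (η 0, η 1, η 2) := by fun_prop
    exact ((measurable_of_countable fun x : A × A × A => h x.1 x.2.1 x.2.2).comp
      hm).aestronglyMeasurable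

/-- The expected weight of the pattern at the sites `1`, `2`, `3`. -/
noncomputable def meanWeight (p : ℝ) (ν : ProbabilityMeasure (ℤ → Option Bool)) : ℝ :=
  ∫ η, polyEval p (weight (η 1) (η 2) (η 3)) ∂(ν : Measure (ℤ → Option Bool))

theorem abs_meanWeight_le (p : ℝ) : ∃ C, ∀ ν, |meanWeight p ν| ≤ C := by
  refine ⟨∑ a, ∑ b, ∑ c, |polyEval p (weight a b c)|, fun ν => ?_⟩
  have h (η : ℤ → Option Bool) : ‖polyEval p (weight (η 1) (η 2) (η 3))‖ ≤
      ∑ a, ∑ b, ∑ c, |polyEval p (weight a b c)| := by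
    refine le_trans ?_ (Finset.single_le_sum (fun a _ => ?_) (Finset.mem_univ (η 1)))
    · refine le_trans ?_ (Finset.single_le_sum (fun a _ => ?_) (Finset.mem_univ (η 2)))
      · exact Finset.single_le_sum (f := fun c => |polyEval p (weight (η 1) (η 2) c)|)
          (fun a _ => abs_nonneg _) (Finset.mem_univ (η 3))
      · exact Finset.sum_nonneg fun _ _ => abs_nonneg _
    · exact Finset.sum_nonneg fun _ _ => Finset.sum_nonneg fun _ _ => abs_nonneg _
  have hn := norm_integral_le_of_norm_le_const (μ := (ν : Measure (ℤ → Option Bool)))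
    (ae_of_all _ h)
  rwa [probReal_univ, mul_one] at hn

theorem measurableSet_eval_eq_none (n : ℤ) :
    MeasurableSet {η : ℤ → Option Bool | η n = none} :=
  (measurable_pi_apply (X := fun _ => Option Bool) n) (measurableSet_singleton none)

/-- The mean weight of a translation invariant law decreases, up to the density of unknown bits. -/
theorem meanWeight_markovStep_le (p : unitInterval) [Fact ((p : ℝ) ≤ 1 / 2)]
    (hp : (p : ℝ) ≤ 1 / 2000000) {ν : ProbabilityMeasure (ℤ → Option Bool)}
    (hν : ν.map (measurable_shift (A := Option Bool)).aemeasurable = ν) :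
    meanWeight p (markovStep (pcaKernel (envelopeRule p)) ν) ≤
      meanWeight p ν - p ^ 2 * (ν : Measure (ℤ → Option Bool)).real {η | η 0 = none} := by
  have hstep : meanWeight p (markovStep (pcaKernel (envelopeRule p)) ν) =
      ∫ η, polyEval p (nextWeight (η 0) (η 1) (η 2) (η 3)) ∂(ν : Measure (ℤ → Option Bool)) := by
    rw [meanWeight, integral_markovStep _ _
      (integrable_four _ fun _ a b c => polyEval p (weight a b c))]
    refine integral_congr_ae (ae_of_all _ fun η => ?_)
    refine (integral_pcaLaw_three (envelopeRule p) η fun a b c => polyEval p (weight a b c)).trans ?_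
    simp only [nextWeight, polyEval_sum, polyEval_mul, envelopeRule_real_singleton]
  have hle : ∫ η, polyEval p (nextWeight (η 0) (η 1) (η 2) (η 3))
        ∂(ν : Measure (ℤ → Option Bool)) ≤
      ∫ η, (polyEval p (weight (η 0) (η 1) (η 2)) + polyEval p (flux (η 0) (η 1) (η 2)) -
        polyEval p (flux (η 1) (η 2) (η 3)) - (if η 0 = none then (p : ℝ) ^ 2 else 0))
        ∂(ν : Measure (ℤ → Option Bool)) := by
    refine integral_mono (integrable_four _ fun a b c d => polyEval p (nextWeight a b c d))
      (integrable_four _ fun a b c d => polyEval p (weight a b c) + polyEval p (flux a b c) -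
        polyEval p (flux b c d) - (if a = none then (p : ℝ) ^ 2 else 0)) fun η => ?_
    have := polyEval_drift_le p.2.1 hp (η 0) (η 1) (η 2) (η 3)
    simp only [drift, polyEval_sub, polyEval_add] at this
    dsimp only
    linarith
  have hnone : ∫ η : ℤ → Option Bool, (if η 0 = none then (p : ℝ) ^ 2 else 0)
      ∂(ν : Measure (ℤ → Option Bool)) =
      p ^ 2 * (ν : Measure (ℤ → Option Bool)).real {η | η 0 = none} := by
    rw [← integral_indicator_one (measurableSet_eval_eq_none 0), ← integral_const_mul]
    refine integral_congr_ae (ae_of_all _ fun η => ?_)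
    by_cases h : η 0 = none <;> simp [h]
  -- Translation invariance gives both flux terms the same mean, so they cancel.
  rw [integral_sub, integral_sub, integral_add, hnone,
    integral_three_shift hν fun a b c => polyEval p (flux a b c)] at hle
  · rw [hstep, meanWeight, integral_three_shift hν fun a b c => polyEval p (weight a b c)]
    linarith
  · exact integrable_four _ fun a b c d => polyEval p (weight a b c)
  · exact integrable_four _ fun a b c d => polyEval p (flux a b c)
  · exact integrable_four _ fun a b c d => polyEval p (weight a b c) + polyEval p (flux a b c)
  · exact integrable_four _ fun a b c d => polyEval p (flux b c d)
  · exact integrable_four _ fun a b c d => polyEval p (weight a b c) + polyEval p (flux a b c) -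
      polyEval p (flux b c d)
  · exact integrable_four _ fun a b c d => if a = none then (p : ℝ) ^ 2 else 0

/-- The configuration of unknown bits. -/
noncomputable def allUnknown : ProbabilityMeasure (ℤ → Option Bool) :=
  ⟨Measure.dirac fun _ => none, inferInstance⟩

/-- The law at time `n` of the envelope automaton started from unknown bits. -/
noncomputable def envelopeLaw (p : unitInterval) [Fact ((p : ℝ) ≤ 1 / 2)] (n : ℕ) :
    ProbabilityMeasure (ℤ → Option Bool) :=
  (markovStep (pcaKernel (envelopeRule p)))^[n] allUnknown

theorem envelopeLaw_map_shift (p : unitInterval) [Fact ((p : ℝ) ≤ 1 / 2)] (n : ℕ) :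
    (envelopeLaw p n).map (measurable_shift (A := Option Bool)).aemeasurable = envelopeLaw p n := by
  refine markovStep_iterate_map_shift _ (Subtype.ext ?_) n
  change (Measure.dirac _).map _ = Measure.dirac _
  exact Measure.map_dirac' measurable_shift _

/-- The density of unknown bits at time `n`. -/
noncomputable def unknownDensity (p : unitInterval) [Fact ((p : ℝ) ≤ 1 / 2)] (n : ℕ) : ℝ :=
  (envelopeLaw p n : Measure (ℤ → Option Bool)).real {η | η 0 = none}

theorem tendsto_unknownDensity (p : unitInterval) [Fact ((p : ℝ) ≤ 1 / 2)] (h0 : 0 < (p : ℝ))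
    (hp : (p : ℝ) ≤ 1 / 2000000) : Tendsto (unknownDensity p) atTop (𝓝 0) := by
  obtain ⟨C, hC⟩ := abs_meanWeight_le p
  -- The decrements of the mean weight telescope. Its values lie in `[-C, C]`, whence the constant
  -- `2 * C / p ^ 2` below.
  have hsum (n : ℕ) : p ^ 2 * ∑ i ∈ Finset.range n, unknownDensity p i ≤
      meanWeight p (envelopeLaw p 0) - meanWeight p (envelopeLaw p n) := by
    induction n with
    | zero => simp
    | succ n ih =>
      have h := meanWeight_markovStep_le p hp (envelopeLaw_map_shift p n)
      have h1 : markovStep (pcaKernel (envelopeRule p)) (envelopeLaw p n) =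
          envelopeLaw p (n + 1) := by
        rw [envelopeLaw, envelopeLaw, Function.iterate_succ_apply']
      rw [h1] at h
      rw [Finset.sum_range_succ, mul_add]
      change _ + (p : ℝ) ^ 2 * (envelopeLaw p n : Measure (ℤ → Option Bool)).real {η | η 0 = none} ≤ _
      linarith
  refine (summable_of_sum_range_le (f := unknownDensity p) (c := 2 * C / p ^ 2)
    (fun n => measureReal_nonneg) fun n => ?_).tendsto_atTop_zero
  rw [le_div_iff₀ (by positivity)]
  have h1 := abs_le.1 (hC (envelopeLaw p 0))
  have h2 := abs_le.1 (hC (envelopeLaw p n))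
  rw [mul_comm]
  linarith [hsum n, h1.2, h2.1]

/-- The density of unknown bits does not depend on the site. -/
theorem envelopeLaw_eval_eq_none (p : unitInterval) [Fact ((p : ℝ) ≤ 1 / 2)] (n : ℕ) (i : ℤ) :
    (envelopeLaw p n : Measure (ℤ → Option Bool)).real {η | η i = none} = unknownDensity p n := by
  have hshift (i : ℤ) : (envelopeLaw p n : Measure (ℤ → Option Bool)).real {η | η (i + 1) = none} =
      (envelopeLaw p n : Measure (ℤ → Option Bool)).real {η | η i = none} := by
    conv_rhs => rw [← envelopeLaw_map_shift]
    rw [ProbabilityMeasure.toMeasure_map, measureReal_def, measureReal_def,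
      Measure.map_apply measurable_shift (measurableSet_eval_eq_none i)]
    rfl
  induction i using Int.induction_on with
  | zero => rfl
  | succ i ih => rw [hshift, ih]
  | pred i ih => rw [← hshift, sub_add_cancel, ih]

/-! ### The coupling with the envelope -/

/-- The masses of cylinders are determined by the envelope up to the density of unknown bits. -/
theorem measureReal_pi_mem_Icc (p : unitInterval) [Fact ((p : ℝ) ≤ 1 / 2)] (s : Finset ℤ)
    (t : ℤ → Set Bool) (n : ℕ) (ν : ProbabilityMeasure (ℤ → Bool)) :
    ((markovStep (pcaKernel (nandEdgeRule p)))^[n] ν : Measure (ℤ → Bool)).real (Set.pi s t) ∈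
      Set.Icc
        ((envelopeLaw p n : Measure (ℤ → Option Bool)).real (Set.pi s fun i => some '' t i))
        ((envelopeLaw p n : Measure (ℤ → Option Bool)).real (Set.pi s fun i => some '' t i) +
          s.card * unknownDensity p n) := by
  have hm1 : Measurable fun (ξ : ℤ → Bool × Option Bool) i => (ξ i).1 := by fun_prop
  have hm2 : Measurable fun (ξ : ℤ → Bool × Option Bool) i => (ξ i).2 := by fun_prop
  have hm0 : Measurable fun (η : ℤ → Bool) i => (η i, (none : Option Bool)) := by fun_prop
  -- Pairing every bit with an unknown one is compatible, and makes the envelope's law independent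
  -- of `ν`.
  let ρ₀ := ν.map hm0.aemeasurable
  let ρ := (markovStep (pcaKernel (coupledRule p)))^[n] ρ₀
  have h1 : ρ.map hm1.aemeasurable = (markovStep (pcaKernel (nandEdgeRule p)))^[n] ν := by
    rw [markovStep_iterate_map (G := pcaKernel (nandEdgeRule p)) hm1
      (pcaLaw_map (coupledRule p) (nandEdgeRule p) (coupledRule_map_fst p))]
    congr 1
    refine Subtype.ext ?_
    change ((ν : Measure (ℤ → Bool)).map _).map _ = (ν : Measure (ℤ → Bool))
    rw [Measure.map_map hm1 hm0]
    exact Measure.map_id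
  have h2 : ρ.map hm2.aemeasurable = envelopeLaw p n := by
    rw [markovStep_iterate_map (G := pcaKernel (envelopeRule p)) hm2
      (pcaLaw_map (coupledRule p) (envelopeRule p) (coupledRule_map_snd p)), envelopeLaw]
    congr 1
    refine Subtype.ext ?_
    change ((ν : Measure (ℤ → Bool)).map _).map _ = Measure.dirac _
    rw [Measure.map_map hm2 hm0]
    refine (Measure.map_const _ (fun _ : ℤ => (none : Option Bool))).trans ?_
    rw [measure_univ, one_smul]
  have hcomp : ∀ᵐ ξ ∂(ρ : Measure (ℤ → Bool × Option Bool)), ∀ i, ξ i ∈ compatible := by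
    refine ae_all_iff.2 fun i => ?_
    rw [ae_iff]
    refine markovStep_iterate_eval_eq_zero (coupledRule p)
      (fun a ha b hb => coupledRule_compl_compatible p ha hb) (fun i => ?_) n i
    change ((ν : Measure (ℤ → Bool)).map _) _ = 0
    have hc : MeasurableSet {ξ : ℤ → Bool × Option Bool | ξ i ∉ compatible} :=
      (measurable_pi_apply (X := fun _ => Bool × Option Bool) i)
        (Set.to_countable compatibleᶜ).measurableSet
    rw [Measure.map_apply hm0 hc]
    convert measure_empty (μ := (ν : Measure (ℤ → Bool)))
    ext η
    simp [compatible]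
  have ht (i : ℤ) : MeasurableSet (t i) := (Set.to_countable _).measurableSet
  have hs1 : MeasurableSet (Set.pi (s : Set ℤ) t) := .pi s.countable_toSet fun _ _ => ht _
  have hs2 : MeasurableSet (Set.pi (s : Set ℤ) fun i => some '' t i) :=
    .pi s.countable_toSet fun _ _ => (Set.to_countable _).measurableSet
  have e1 : ((markovStep (pcaKernel (nandEdgeRule p)))^[n] ν : Measure (ℤ → Bool)).real
      (Set.pi s t) = (ρ : Measure (ℤ → Bool × Option Bool)).real {ξ | ∀ i ∈ s, (ξ i).1 ∈ t i} := by
    rw [← h1, ProbabilityMeasure.toMeasure_map, measureReal_def, Measure.map_apply hm1 hs1]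
    rfl
  have e2 : (envelopeLaw p n : Measure (ℤ → Option Bool)).real
      (Set.pi s fun i => some '' t i) =
      (ρ : Measure (ℤ → Bool × Option Bool)).real {ξ | ∀ i ∈ s, (ξ i).2 ∈ some '' t i} := by
    rw [← h2, ProbabilityMeasure.toMeasure_map, measureReal_def, Measure.map_apply hm2 hs2]
    rfl
  have e3 (i : ℤ) : (ρ : Measure (ℤ → Bool × Option Bool)).real {ξ | (ξ i).2 = none} =
      unknownDensity p n := by
    rw [← envelopeLaw_eval_eq_none p n i, ← h2, ProbabilityMeasure.toMeasure_map, measureReal_def,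
      measureReal_def, Measure.map_apply hm2 (measurableSet_eval_eq_none i)]
    rfl
  rw [e1, e2]
  constructor
  · refine ENNReal.toReal_mono (measure_ne_top _ _) (measure_mono_ae ?_)
    filter_upwards [hcomp] with ξ hξ h i hi
    obtain ⟨b, hb, hbi⟩ := h i hi
    rcases hξ i with h | h
    · rw [h] at hbi; cases hbi
    · rw [h] at hbi; cases hbi; exact hb
  -- Off the event of an unknown symbol in `s`, the symbols equal the bits; a union bound controls
  -- that event.
  · have hunion : (ρ : Measure (ℤ → Bool × Option Bool)).real {ξ | ∀ i ∈ s, (ξ i).1 ∈ t i} ≤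
        (ρ : Measure (ℤ → Bool × Option Bool)).real
          ({ξ | ∀ i ∈ s, (ξ i).2 ∈ some '' t i} ∪ ⋃ i ∈ s, {ξ | (ξ i).2 = none}) := by
      refine ENNReal.toReal_mono (measure_ne_top _ _) (measure_mono_ae ?_)
      filter_upwards [hcomp] with ξ hξ h
      by_cases hn : ∃ i ∈ s, (ξ i).2 = none
      · obtain ⟨i, hi, hn⟩ := hn
        exact Or.inr (Set.mem_biUnion hi hn)
      · push Not at hn
        exact Or.inl fun i hi => ⟨(ξ i).1, h i hi, ((hξ i).resolve_left (hn i hi)).symm⟩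
    refine hunion.trans ((measureReal_union_le _ _).trans (add_le_add le_rfl ?_))
    refine (measureReal_biUnion_finset_le _ _).trans ?_
    simp only [e3, Finset.sum_const, nsmul_eq_mul, le_refl]

theorem mainTheorem3 :
    ∃ ε : ℝ, 0 < ε ∧ ε ≤ 1 ∧ ∀ p : unitInterval, 0 < (p : ℝ) → (p : ℝ) < ε →
      IsErgodicChain (pcaKernel (nandEdgeRule p)) := by
  -- The threshold is the reciprocal of the tail bound in `driftCheck_all`.
  refine ⟨1 / 2000000, by norm_num, by norm_num, fun p h0 hp => ?_⟩
  have : Fact ((p : ℝ) ≤ 1 / 2) := ⟨by linarith⟩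
  refine isErgodicChain_of_pi _ fun s t =>
    ⟨fun n => (envelopeLaw p n : Measure (ℤ → Option Bool)).real (Set.pi s fun i => some '' t i),
      fun n => s.card * unknownDensity p n, ?_, fun n ν => measureReal_pi_mem_Icc p s t n ν⟩
  simpa using (tendsto_unknownDensity p h0 hp.le).const_mul (s.card : ℝ)
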